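/- Corollary. Call a nonempty set $K\subseteq\mathbb{R}^n$ a convex cone if $tx+sy\in K$ for all $x,y\in K$ and $t,s\ge 0$; call it a proper cone if moreover $K$ is closed, $K\cap(-K)=\{0\}$ and $K$ has nonempty interior, and polyhedral if it is closed and is the conic hull of a finite set. A nonzero vector $x\in K$ is an extreme vector of $K$ if $x=y+z$ with $y,z\in K$ implies that $y$ and $z$ are nonnegative scalar multiples of $x$. A convex cone $K$ is reducible if $K=K_1+K_2$ for some nonempty sets $K_1,K_2\subseteq\mathbb{R}^n$, both different from $\{0\}$, with $\operatorname{span}(K_1)\cap\operatorname{span}(K_2)=\{0\}$; a convex cone $K\ne\{0\}$ is irreducible if it is not reducible. Let $K^*=\{s\in\mathbb{R}^n:\langle x,s\rangle\ge 0 \text{ for all } x\in K\}$. The Lyapunov rank $\beta(K)$ of a proper cone $K$ is the dimension of the real vector space of all linear maps $L:\mathbb{R}^n\to\mathbb{R}^n$ such that $\langle L(x),s\rangle=0$ whenever $x\in K$, $s\in K^*$ and $\langle x,s\rangle=0$. Let $Q$ be a proper polyhedral cone in $\mathbb{R}^n$ that is permutation invariant, i.e. $\sigma(Q)=Q$ for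 every permutation $\sigma$ of the coordinates of $\mathbb{R}^n$. Suppose that $Q$ has two extreme vectors $d_1,d_2$ such that, for every permutation $\sigma$ of the coordinates, $\sigma(d_1)$ is not a positive scalar multiple of $d_2$. Then $Q$ is irreducible and $\beta(Q)=1$. -/

import Mathlib

open scoped Pointwise InnerProductSpace

namespace LyapunovCone

section General

variable {V : Type*} [NormedAddCommGroup V] [InnerProductSpace ℝ V] [CompleteSpace V]

/-- A convex cone (containing `0`) is proper if it is closed, pointed (`K ∩ -K = {0}`) and solid
(nonempty interior). -/
structure IsProper (K : PointedCone ℝ V) : Prop where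
  isClosed : IsClosed (K : Set V)
  pointed : (K : Set V) ∩ -(K : Set V) = {0}
  solid : (interior (K : Set V)).Nonempty

/-- A polyhedral cone is a closed convex cone that is the conic hull of a finite set. -/
def IsPolyhedral (K : PointedCone ℝ V) : Prop :=
  IsClosed (K : Set V) ∧ ∃ S : Set V, S.Finite ∧ K = PointedCone.hull ℝ S

/-- `x` is an extreme vector of `K`: a nonzero element of `K` such that whenever `x = y + z` with
`y, z ∈ K`, both `y` and `z` are nonnegative multiples of `x`. -/
def IsExtremeVector (K : PointedCone ℝ V) (x : V) : Prop :=
  x ∈ K ∧ x ≠ 0 ∧ ∀ y ∈ K, ∀ z ∈ K, x = y + z →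
    (∃ a : ℝ, 0 ≤ a ∧ y = a • x) ∧ (∃ b : ℝ, 0 ≤ b ∧ z = b • x)

/-- Extreme vectors are identified when they are positive scalar multiples of each other. -/
def Equivalent (x y : V) : Prop := ∃ c : ℝ, 0 < c ∧ x = c • y

/-- `K = K₁ + K₂` for nonempty nonzero sets `K₁, K₂` whose spans meet only in `0`. -/
def IsReducible (K : PointedCone ℝ V) : Prop :=
  ∃ K₁ K₂ : Set V, K₁.Nonempty ∧ K₁ ≠ {0} ∧ K₂.Nonempty ∧ K₂ ≠ {0} ∧
    (K : Set V) = K₁ + K₂ ∧ Submodule.span ℝ K₁ ⊓ Submodule.span ℝ K₂ = ⊥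

/-- A nonzero convex cone is irreducible if it is not reducible. -/
def IsIrreducible (K : PointedCone ℝ V) : Prop := K ≠ ⊥ ∧ ¬ IsReducible K

/-- The real vector space `LL(K)` of Lyapunov-like transformations on `K`. -/
def lyapunovLike (K : PointedCone ℝ V) : Submodule ℝ (V →ₗ[ℝ] V) where
  carrier := {L | ∀ x ∈ K, ∀ s ∈ ProperCone.innerDual (K : Set V), ⟪x, s⟫_ℝ = 0 → ⟪L x, s⟫_ℝ = 0}
  zero_mem' := by
    intro x _ s _ _
    simp
  add_mem' := by
    intro L M hL hM x hx s hs h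
    simp [inner_add_left, hL x hx s hs h, hM x hx s hs h]
  smul_mem' := by
    intro c L hL x hx s hs h
    simp [inner_smul_left, hL x hx s hs h]

/-- The Lyapunov rank `β(K) = dim LL(K)`. -/
noncomputable def lyapunovRank (K : PointedCone ℝ V) : ℕ := Module.finrank ℝ (lyapunovLike K)

end General

/-- The action of a permutation on `ℝⁿ` by permuting coordinates: `(σ x) (σ i) = x i`. -/
noncomputable def permute {n : ℕ} (σ : Equiv.Perm (Fin n)) :
    EuclideanSpace ℝ (Fin n) ≃ₗᵢ[ℝ] EuclideanSpace ℝ (Fin n) :=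
  LinearIsometryEquiv.piLpCongrLeft 2 ℝ ℝ σ

/-- `σ(Q) = Q` for every permutation `σ`. -/
def IsPermInvariant {n : ℕ} (Q : PointedCone ℝ (EuclideanSpace ℝ (Fin n))) : Prop :=
  ∀ σ : Equiv.Perm (Fin n),
    permute σ '' (Q : Set (EuclideanSpace ℝ (Fin n))) = (Q : Set (EuclideanSpace ℝ (Fin n)))

end LyapunovCone

namespace LyapunovCone

/-! ### Extreme vectors of pointed and polyhedral cones. -/

section General

variable {V : Type*} [NormedAddCommGroup V] [InnerProductSpace ℝ V]

/-! Both conclusions follow once every linear map `L` with all extreme vectors as eigenvectors is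
scalar. Lyapunov-like maps of a polyhedral cone are of this kind because its extreme rays are
exposed, and a reduction of `Q` would give a non-scalar projection of this kind.

For a transposition τ, put D = L - τLτ. It again has the extreme vectors as eigenvectors, has rank
at most two because τ - 1 has rank at most one, and satisfies τDτ = -D. If Dd = ad with a ≠ 0, then
d and τd span the range of D, so any extreme vector not killed by D is a multiple of d or τd
(`exists_permute_equivalent_of_swapDefect_ne_zero`). With two orbits, some extreme e has its whole
orbit killed by D. The sum of the maps σ⁻¹D²σ commutes with permutations; its eigenvalue is 0 at e
and positive at d. But such a map has only one eigenvalue on extreme vectors, since orbit sums are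
nonzero and have constant coordinates (`eigenvalue_eq_of_commute`). Hence D = 0, so L commutes with
all permutations, and the same lemma makes L scalar. -/

theorem IsProper.eq_zero_of_neg_mem {K : PointedCone ℝ V} (hK : IsProper K) {x : V}
    (hx : x ∈ K) (hx' : -x ∈ K) : x = 0 := by
  have : x ∈ (K : Set V) ∩ -(K : Set V) := ⟨hx, hx'⟩
  rw [hK.pointed] at this
  exact this

theorem IsProper.eq_zero_of_add_eq_zero {K : PointedCone ℝ V} (hK : IsProper K) {x y : V}
    (hx : x ∈ K) (hy : y ∈ K) (h : x + y = 0) : x = 0 :=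
  hK.eq_zero_of_neg_mem hx (by rwa [neg_eq_of_add_eq_zero_right h])

theorem IsProper.pos_of_smul_mem {K : PointedCone ℝ V} (hK : IsProper K) {x : V} {c : ℝ}
    (hx : x ∈ K) (hcx : c • x ∈ K) (h0 : c • x ≠ 0) : 0 < c := by
  by_contra! hc
  refine h0 (hK.eq_zero_of_neg_mem hcx ?_)
  rw [← neg_smul]
  exact PointedCone.smul_mem _ (by linarith) hx

theorem IsExtremeVector.left_mem_span {K : PointedCone ℝ V} {d : V} (hd : IsExtremeVector K d)
    {c : ℝ} (hc : 0 < c) {y z : V} (hy : y ∈ K) (hz : z ∈ K) (h : c • d = y + z) :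
    y ∈ Submodule.span ℝ {d} := by
  have hi : 0 ≤ c⁻¹ := by positivity
  obtain ⟨⟨a, -, ha⟩, -⟩ := hd.2.2 _ (PointedCone.smul_mem _ hi hy) _ (PointedCone.smul_mem _ hi hz)
    (by rw [← smul_add, ← h, inv_smul_smul₀ hc.ne'])
  refine Submodule.mem_span_singleton.2 ⟨c * a, ?_⟩
  rw [mul_smul, ← ha, smul_inv_smul₀ hc.ne']

/-- The span of an extreme vector absorbs positive summands of its elements. -/
theorem IsExtremeVector.mem_span_of_smul_add_mem {K : PointedCone ℝ V} {d : V}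
    (hd : IsExtremeVector K d) {a : ℝ} (ha : 0 < a) {x y : V} (hx : x ∈ K) (hy : y ∈ K)
    (h : a • x + y ∈ Submodule.span ℝ {d}) : x ∈ Submodule.span ℝ {d} := by
  obtain ⟨c, hc⟩ := Submodule.mem_span_singleton.1 h
  -- The multiple c may be nonpositive; adding (|c| + 1) • d to the second summand makes the total a
  -- positive multiple of d.
  have hpos : 0 < c + (|c| + 1) := by linarith [neg_abs_le c]
  have := hd.left_mem_span hpos (PointedCone.smul_mem _ ha.le hx)
    (K.add_mem hy (PointedCone.smul_mem _ (by positivity : 0 ≤ |c| + 1) hd.1))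
    (by rw [add_smul, hc, add_assoc])
  exact (Submodule.smul_mem_iff _ ha.ne').1 this

/-- Convexity keeps the hull of the generators off the line of d disjoint from that line, as
Hahn–Banach separation requires. -/
theorem IsExtremeVector.convex_diff_span {K : PointedCone ℝ V} {d : V}
    (hd : IsExtremeVector K d) : Convex ℝ {x | x ∈ K ∧ x ∉ Submodule.span ℝ {d}} := by
  rintro x ⟨hx, hxd⟩ y ⟨hy, hyd⟩ a b ha hb hab
  refine ⟨K.add_mem (PointedCone.smul_mem _ ha hx) (PointedCone.smul_mem _ hb hy), fun h => ?_⟩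
  rcases ha.lt_or_eq with ha' | rfl
  · exact hxd (hd.mem_span_of_smul_add_mem ha' hx (PointedCone.smul_mem _ hb hy) h)
  · refine hyd (hd.mem_span_of_smul_add_mem (a := b) (by linarith) hy (K.zero_mem) ?_)
    simpa using h

/-- An extreme ray of a polyhedral cone is exposed, strictly with respect to a finite set of
generators. -/
theorem IsExtremeVector.exists_exposing [FiniteDimensional ℝ V] {K : PointedCone ℝ V} {d : V}
    (hd : IsExtremeVector K d) {S : Set V} (hS : S.Finite) (hSK : S ⊆ K) :
    ∃ w : V, ⟪d, w⟫_ℝ = 0 ∧ ∀ t ∈ S, t ∉ Submodule.span ℝ {d} → 0 < ⟪t, w⟫_ℝ := by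
  set T : Set V := {t | t ∈ S ∧ t ∉ Submodule.span ℝ {d}} with hT
  have hTf : T.Finite := hS.subset fun t ht => ht.1
  have hsub : convexHull ℝ T ⊆ {x | x ∈ K ∧ x ∉ Submodule.span ℝ {d}} :=
    convexHull_min (fun t ht => ⟨hSK ht.1, ht.2⟩) hd.convex_diff_span
  have hdisj : Disjoint (convexHull ℝ T) (Submodule.span ℝ {d} : Set V) :=
    Set.disjoint_left.2 fun x hx hx' => (hsub hx).2 hx'
  obtain ⟨f, u, v, hu, huv, hv⟩ := geometric_hahn_banach_compact_closed (convex_convexHull ℝ T)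
    (hTf.isCompact_convexHull ℝ) (Submodule.span ℝ {d}).convex
    (Submodule.span ℝ {d}).closed_of_finiteDimensional hdisj
  have hfd : f d = 0 := by
    by_contra hne
    -- A functional bounded below on a line vanishes there: this multiple of d has value v - 1.
    have := hv (((v - 1) / f d) • d) (Submodule.smul_mem _ _ (Submodule.mem_span_singleton_self d))
    rw [map_smul, smul_eq_mul, div_mul_cancel₀ _ hne] at this
    linarith
  have hv0 : v < 0 := by simpa using hv 0 (Submodule.zero_mem _)
  refine ⟨-(InnerProductSpace.toDual ℝ V).symm f, ?_, fun t ht htd => ?_⟩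
  · rw [inner_neg_right, real_inner_comm, InnerProductSpace.toDual_symm_apply, hfd, neg_zero]
  · rw [inner_neg_right, real_inner_comm, InnerProductSpace.toDual_symm_apply]
    have := hu t (subset_convexHull ℝ T ⟨ht, htd⟩)
    linarith

theorem hull_inner_nonneg {S : Set V} {w : V} (h : ∀ t ∈ S, 0 ≤ ⟪t, w⟫_ℝ) {x : V}
    (hx : x ∈ PointedCone.hull ℝ S) : 0 ≤ ⟪x, w⟫_ℝ := by
  induction hx using Submodule.span_induction with
  | mem x hx => exact h x hx
  | zero => simp
  | add x y _ _ hx hy => rw [inner_add_left]; positivity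
  | smul a x _ hx =>
    have : a • x = (a : ℝ) • x := rfl
    rw [this, real_inner_smul_left]
    exact mul_nonneg a.2 hx

/-- Lyapunov-like maps of a polyhedral cone have all extreme vectors as eigenvectors. -/
theorem IsExtremeVector.exists_eq_smul_of_lyapunovLike [FiniteDimensional ℝ V]
    {K : PointedCone ℝ V} {d : V} (hd : IsExtremeVector K d) (hK : IsPolyhedral K)
    {L : V →ₗ[ℝ] V} (hL : L ∈ lyapunovLike K) : ∃ c : ℝ, L d = c • d := by
  obtain ⟨S, hS, rfl⟩ := hK.2
  have hSK : S ⊆ (PointedCone.hull ℝ S : PointedCone ℝ V) := Submodule.subset_span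
  obtain ⟨w, hdw, hw⟩ := hd.exists_exposing hS hSK
  have key : ∀ z : V, ⟪d, z⟫_ℝ = 0 → (∀ t ∈ S, t ∉ Submodule.span ℝ {d} → 0 ≤ ⟪t, z⟫_ℝ) →
      ⟪L d, z⟫_ℝ = 0 := by
    intro z hz hzS
    refine hL d hd.1 z (ProperCone.mem_innerDual.2 fun x hx => hull_inner_nonneg ?_ hx) hz
    intro t ht
    by_cases htd : t ∈ Submodule.span ℝ {d}
    · obtain ⟨a, rfl⟩ := Submodule.mem_span_singleton.1 htd
      rw [real_inner_smul_left, hz, mul_zero]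
    · exact hzS t ht htd
  have hLw := key w hdw fun t ht htd => (hw t ht htd).le
  suffices h : L d ∈ (Submodule.span ℝ {d})ᗮᗮ by
    rw [Submodule.orthogonal_orthogonal] at h
    obtain ⟨c, hc⟩ := Submodule.mem_span_singleton.1 h
    exact ⟨c, hc.symm⟩
  rw [Submodule.mem_orthogonal]
  intro v hv
  have hdv : ⟪d, v⟫_ℝ = 0 := Submodule.mem_orthogonal_singleton_iff_inner_right.1 hv
  -- The finitely many strict inequalities for w survive a small perturbation along v. Then L d is
  -- orthogonal to both w and w + ε • v, hence to v.
  have hev : ∀ᶠ ε : ℝ in nhdsWithin 0 (Set.Ioi 0),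
      ∀ t ∈ S, t ∉ Submodule.span ℝ {d} → 0 ≤ ⟪t, w + ε • v⟫_ℝ := by
    rw [Filter.eventually_all_finite hS]
    intro t ht
    by_cases htd : t ∈ Submodule.span ℝ {d}
    · exact Filter.Eventually.of_forall fun _ h => absurd htd h
    have hc : Filter.Tendsto (fun ε : ℝ => ⟪t, w + ε • v⟫_ℝ) (nhdsWithin 0 (Set.Ioi 0))
        (nhds ⟪t, w + (0 : ℝ) • v⟫_ℝ) :=
      ((by fun_prop : Continuous fun ε : ℝ => ⟪t, w + ε • v⟫_ℝ).tendsto 0).mono_left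
        nhdsWithin_le_nhds
    have h0 : 0 < ⟪t, w + (0 : ℝ) • v⟫_ℝ := by simpa using hw t ht htd
    filter_upwards [hc.eventually (lt_mem_nhds h0)] with ε hε _ using hε.le
  obtain ⟨ε, hε, hε0⟩ := (hev.and self_mem_nhdsWithin).exists
  have h := key (w + ε • v) (by simp [inner_add_right, real_inner_smul_right, hdw, hdv]) hε
  rw [inner_add_right, real_inner_smul_right, hLw, zero_add] at h
  rw [real_inner_comm]
  exact (mul_eq_zero.1 h).resolve_left (ne_of_gt hε0)

/-! ### Generation by extreme vectors. -/

/-- An irredundant generator of a proper cone is an extreme vector. -/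
theorem IsProper.isExtremeVector_of_notMem_hull {K : PointedCone ℝ V} (hK : IsProper K)
    {s : V} {S : Set V} (hSK : K = PointedCone.hull ℝ (insert s S))
    (hs : s ∉ PointedCone.hull ℝ S) : IsExtremeVector K s := by
  have hsK : s ∈ K := by rw [hSK]; exact Submodule.subset_span (Set.mem_insert _ _)
  have hle : PointedCone.hull ℝ S ≤ K := by
    rw [hSK]; exact Submodule.span_mono (Set.subset_insert _ _)
  have hdec : ∀ y ∈ K, ∃ a : ℝ, 0 ≤ a ∧ ∃ w ∈ PointedCone.hull ℝ S, y = a • s + w := by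
    intro y hy
    rw [hSK] at hy
    obtain ⟨a, w, hw, rfl⟩ := Submodule.mem_span_insert.1 hy
    exact ⟨a, a.2, w, hw, rfl⟩
  refine ⟨hsK, fun h => hs (h ▸ Submodule.zero_mem _), fun y hy z hz h => ?_⟩
  obtain ⟨a, ha, v, hv, rfl⟩ := hdec y hy
  obtain ⟨b, hb, w, hw, rfl⟩ := hdec z hz
  have h1 : (1 - (a + b)) • s = v + w := by
    rw [sub_smul, one_smul, add_smul, sub_eq_iff_eq_add]
    nth_rewrite 1 [h]
    abel
  -- If a + b < 1, then s is a positive multiple of v + w, contrary to irredundancy. So v + w is a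
  -- nonpositive multiple of s, and pointedness makes it zero.
  have hab : 1 ≤ a + b := by
    by_contra! hlt
    refine hs ?_
    have hpos : 0 < 1 - (a + b) := by linarith
    rw [← inv_smul_smul₀ hpos.ne' s, h1]
    exact PointedCone.smul_mem _ (by positivity) (Submodule.add_mem _ hv hw)
  have hvw : v + w = 0 := by
    refine hK.eq_zero_of_neg_mem (hle (Submodule.add_mem _ hv hw)) ?_
    rw [← h1, ← neg_smul]
    exact PointedCone.smul_mem _ (by linarith) hsK
  have hv0 := hK.eq_zero_of_add_eq_zero (hle hv) (hle hw) hvw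
  have hw0 := hK.eq_zero_of_add_eq_zero (hle hw) (hle hv) (by rw [add_comm, hvw])
  exact ⟨⟨a, ha, by rw [hv0, add_zero]⟩, ⟨b, hb, by rw [hw0, add_zero]⟩⟩

/-- A finitely generated pointed cone is generated by finitely many extreme vectors. -/
theorem IsProper.exists_extreme_generators {K : PointedCone ℝ V} (hK : IsProper K)
    (S : Finset V) (hS : K = PointedCone.hull ℝ (S : Set V)) :
    ∃ T : Set V, (∀ t ∈ T, IsExtremeVector K t) ∧ K = PointedCone.hull ℝ T := by
  classical
  induction S using Finset.strongInduction with
  | H S ih =>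
    by_cases h : ∀ s ∈ S, s ∉ PointedCone.hull ℝ ((S.erase s : Finset V) : Set V)
    · refine ⟨S, fun s hs => hK.isExtremeVector_of_notMem_hull ?_ (h s hs), hS⟩
      rw [← Finset.coe_insert, Finset.insert_erase hs, hS]
    · push Not at h
      obtain ⟨s, hs, hmem⟩ := h
      refine ih _ (Finset.erase_ssubset hs) ?_
      rw [hS, ← Finset.insert_erase hs, Finset.coe_insert, Finset.erase_insert_eq_erase,
        Finset.erase_idem]
      exact Submodule.span_insert_eq_span hmem

theorem IsProper.span_eq_top {K : PointedCone ℝ V} (hK : IsProper K) :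
    Submodule.span ℝ (K : Set V) = ⊤ :=
  Submodule.eq_top_of_nonempty_interior' _ (hK.solid.mono (interior_mono Submodule.subset_span))

theorem IsProper.span_isExtremeVector {K : PointedCone ℝ V} (hK : IsProper K)
    (hP : IsPolyhedral K) : Submodule.span ℝ {d | IsExtremeVector K d} = ⊤ := by
  obtain ⟨S, hS, hKS⟩ := hP.2
  obtain ⟨T, hT, hKT⟩ := hK.exists_extreme_generators hS.toFinset (by simpa using hKS)
  rw [eq_top_iff, ← hK.span_eq_top, Submodule.span_le]
  intro x hx
  rw [hKT] at hx
  have : PointedCone.hull ℝ T ≤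
      (Submodule.span ℝ {d | IsExtremeVector K d}).restrictScalars {c : ℝ // 0 ≤ c} :=
    Submodule.span_le.2 fun t ht => Submodule.subset_span (hT t ht)
  exact this hx

/-! ### Diagonal maps, irreducibility and Lyapunov rank. -/

/-- `L` acts as a scalar on every extreme ray of `K`. -/
def IsDiagonalOn (K : PointedCone ℝ V) (L : V →ₗ[ℝ] V) : Prop :=
  ∀ d, IsExtremeVector K d → ∃ c : ℝ, L d = c • d

/-- If only scalar maps are diagonal on the extreme rays, the cone is not reducible. -/
theorem IsProper.not_isReducible {K : PointedCone ℝ V} (hK : IsProper K)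
    (h : ∀ L, IsDiagonalOn K L → ∃ μ : ℝ, ∀ x, L x = μ • x) : ¬ IsReducible K := by
  rintro ⟨K₁, K₂, -, hK₁, -, hK₂, hsum, hinf⟩
  have hzero : ∀ x ∈ Submodule.span ℝ K₁, x ∈ Submodule.span ℝ K₂ → x = 0 := fun x h₁ h₂ =>
    (Submodule.mem_bot ℝ).1 (hinf ▸ Submodule.mem_inf.2 ⟨h₁, h₂⟩)
  -- Decomposing 0 shows that both sets contain 0, hence that both lie in K.
  have h0 : (0 : V) ∈ (K : Set V) := K.zero_mem
  rw [hsum] at h0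
  obtain ⟨a, ha, b, hb, hab⟩ := h0
  have ha0 : a = 0 := hzero a (Submodule.subset_span ha) (by
    rw [eq_neg_of_add_eq_zero_left hab]
    exact Submodule.neg_mem _ (Submodule.subset_span hb))
  have hb0 : b = 0 := by simpa [ha0] using hab
  subst ha0 hb0
  have hsub₁ : K₁ ⊆ K := fun x hx => hsum ▸ ⟨x, hx, 0, hb, add_zero x⟩
  have hsub₂ : K₂ ⊆ K := fun x hx => hsum ▸ ⟨0, ha, x, hx, zero_add x⟩
  have hcompl : IsCompl (Submodule.span ℝ K₁) (Submodule.span ℝ K₂) := by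
    refine ⟨disjoint_iff.2 hinf, codisjoint_iff.2 ?_⟩
    rw [eq_top_iff, ← hK.span_eq_top, Submodule.span_le, hsum]
    rintro _ ⟨x, hx, y, hy, rfl⟩
    exact Submodule.add_mem_sup (Submodule.subset_span hx) (Submodule.subset_span hy)
  set P := Submodule.projection _ _ hcompl
  have hp₁ : ∀ x ∈ Submodule.span ℝ K₁, P x = x := fun x hx =>
    Submodule.projection_apply_of_mem_left hcompl hx
  have hp₂ : ∀ x ∈ Submodule.span ℝ K₂, P x = 0 := fun x hx =>
    (Submodule.projection_apply_eq_zero_iff hcompl).2 hx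
  -- Extremality makes the K₁-component of d a multiple of d, so P is diagonal. As a scalar map it
  -- would have to be both 1 on K₁ and 0 on K₂.
  obtain ⟨μ, hμ⟩ := h P (by
    intro d hd
    have hdK : d ∈ (K : Set V) := hd.1
    rw [hsum] at hdK
    obtain ⟨x, hx, y, hy, hxy⟩ := hdK
    obtain ⟨⟨s, -, hs⟩, -⟩ := hd.2.2 x (hsub₁ hx) y (hsub₂ hy) hxy.symm
    refine ⟨s, ?_⟩
    rw [← hs]
    conv_lhs => rw [← hxy]
    show P (x + y) = x
    rw [map_add, hp₁ x (Submodule.subset_span hx), hp₂ y (Submodule.subset_span hy), add_zero])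
  obtain ⟨x, hx, hx0⟩ : ∃ x ∈ K₁, x ≠ 0 := by
    by_contra! hc
    exact hK₁ (Set.eq_singleton_iff_unique_mem.2 ⟨ha, hc⟩)
  obtain ⟨y, hy, hy0⟩ : ∃ y ∈ K₂, y ≠ 0 := by
    by_contra! hc
    exact hK₂ (Set.eq_singleton_iff_unique_mem.2 ⟨hb, hc⟩)
  have hy' := hμ y
  rw [hp₂ y (Submodule.subset_span hy), eq_comm, smul_eq_zero] at hy'
  have hx' := hμ x
  rw [hp₁ x (Submodule.subset_span hx), hy'.resolve_right hy0, zero_smul] at hx'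
  exact hx0 hx'

theorem IsPolyhedral.lyapunovRank_eq_one [FiniteDimensional ℝ V] {K : PointedCone ℝ V}
    (hP : IsPolyhedral K) {d : V} (hd : d ≠ 0)
    (h : ∀ L, IsDiagonalOn K L → ∃ μ : ℝ, ∀ x, L x = μ • x) : lyapunovRank K = 1 := by
  have hspan : lyapunovLike K = Submodule.span ℝ {LinearMap.id} := by
    ext L
    rw [Submodule.mem_span_singleton]
    constructor
    · intro hL
      obtain ⟨μ, hμ⟩ := h L fun e he => he.exists_eq_smul_of_lyapunovLike hP hL
      exact ⟨μ, LinearMap.ext fun x => (hμ x).symm⟩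
    · rintro ⟨μ, rfl⟩ x _ s _ hxs
      simp [real_inner_smul_left, hxs]
  rw [lyapunovRank, hspan]
  exact finrank_span_singleton fun h0 => hd (by simpa using LinearMap.congr_fun h0 d)

end General

/-! ### Coordinate permutations and orbit sums. -/

section Permutation

variable {n : ℕ} {Q : PointedCone ℝ (EuclideanSpace ℝ (Fin n))}

@[simp]
theorem permute_apply (σ : Equiv.Perm (Fin n)) (x : EuclideanSpace ℝ (Fin n)) (i : Fin n) :
    permute σ x i = x (σ⁻¹ i) := rfl

theorem permute_mul (σ τ : Equiv.Perm (Fin n)) (x : EuclideanSpace ℝ (Fin n)) :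
    permute (σ * τ) x = permute σ (permute τ x) := rfl

@[simp]
theorem permute_one (x : EuclideanSpace ℝ (Fin n)) : permute 1 x = x := rfl

@[simp]
theorem permute_inv_permute (σ : Equiv.Perm (Fin n)) (x : EuclideanSpace ℝ (Fin n)) :
    permute σ⁻¹ (permute σ x) = x := by
  rw [← permute_mul, inv_mul_cancel, permute_one]

@[simp]
theorem permute_permute_inv (σ : Equiv.Perm (Fin n)) (x : EuclideanSpace ℝ (Fin n)) :
    permute σ (permute σ⁻¹ x) = x := by
  rw [← permute_mul, mul_inv_cancel, permute_one]

theorem permute_swap_permute_swap (i j : Fin n) (x : EuclideanSpace ℝ (Fin n)) :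
    permute (Equiv.swap i j) (permute (Equiv.swap i j) x) = x := by
  rw [← permute_mul, Equiv.swap_mul_self, permute_one]

/-- A transposition is the identity plus a map of rank one. -/
theorem permute_swap_eq (i j : Fin n) (x : EuclideanSpace ℝ (Fin n)) :
    permute (Equiv.swap i j) x =
      x - (x i - x j) • (EuclideanSpace.single i (1 : ℝ) - EuclideanSpace.single j (1 : ℝ)) := by
  ext k
  simp only [permute_apply, Equiv.swap_inv, PiLp.sub_apply, PiLp.smul_apply,
    PiLp.single_apply, smul_eq_mul]
  by_cases hki : k = i
  · subst hki
    by_cases hkj : k = j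
    · subst hkj; simp
    · simp [hkj]
  · by_cases hkj : k = j
    · subst hkj; simp [hki]
    · simp [hki, hkj, Equiv.swap_apply_of_ne_of_ne hki hkj]

theorem IsPermInvariant.permute_mem (hQ : IsPermInvariant Q) (σ : Equiv.Perm (Fin n))
    {x : EuclideanSpace ℝ (Fin n)} (hx : x ∈ Q) : permute σ x ∈ Q := by
  have : permute σ x ∈ permute σ '' (Q : Set _) := ⟨x, hx, rfl⟩
  rwa [hQ σ] at this

theorem IsPermInvariant.isExtremeVector_permute (hQ : IsPermInvariant Q)
    (σ : Equiv.Perm (Fin n)) {d : EuclideanSpace ℝ (Fin n)} (hd : IsExtremeVector Q d) :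
    IsExtremeVector Q (permute σ d) := by
  refine ⟨hQ.permute_mem σ hd.1, by simpa using hd.2.1, fun y hy z hz h => ?_⟩
  obtain ⟨⟨a, ha, hya⟩, ⟨b, hb, hzb⟩⟩ := hd.2.2 _ (hQ.permute_mem σ⁻¹ hy) _
    (hQ.permute_mem σ⁻¹ hz) (by rw [← map_add, ← h, permute_inv_permute])
  exact ⟨⟨a, ha, by rw [← map_smul, ← hya, permute_permute_inv]⟩,
    ⟨b, hb, by rw [← map_smul, ← hzb, permute_permute_inv]⟩⟩

theorem Equivalent.permute {x y : EuclideanSpace ℝ (Fin n)} (h : Equivalent x y)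
    (σ : Equiv.Perm (Fin n)) : Equivalent (permute σ x) (permute σ y) := by
  obtain ⟨c, hc, rfl⟩ := h
  exact ⟨c, hc, map_smul _ _ _⟩

theorem Equivalent.symm {x y : EuclideanSpace ℝ (Fin n)} (h : Equivalent x y) :
    Equivalent y x := by
  obtain ⟨c, hc, rfl⟩ := h
  exact ⟨c⁻¹, by positivity, (inv_smul_smul₀ hc.ne' y).symm⟩

theorem Equivalent.trans {x y z : EuclideanSpace ℝ (Fin n)} (h : Equivalent x y)
    (h' : Equivalent y z) : Equivalent x z := by
  obtain ⟨c, hc, rfl⟩ := h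
  obtain ⟨c', hc', rfl⟩ := h'
  exact ⟨c * c', by positivity, (mul_smul _ _ _).symm⟩

/-- The sum of all coordinate permutations of `x`. -/
noncomputable def permSum (x : EuclideanSpace ℝ (Fin n)) : EuclideanSpace ℝ (Fin n) :=
  ∑ σ : Equiv.Perm (Fin n), permute σ x

theorem permute_permSum (τ : Equiv.Perm (Fin n)) (x : EuclideanSpace ℝ (Fin n)) :
    permute τ (permSum x) = permSum x := by
  rw [permSum, map_sum]
  simp_rw [← permute_mul]
  exact Fintype.sum_equiv (Equiv.mulLeft τ) _ _ fun _ => rfl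

theorem permSum_apply_eq (x : EuclideanSpace ℝ (Fin n)) (i j : Fin n) :
    permSum x i = permSum x j := by
  conv_lhs => rw [← permute_permSum (Equiv.swap i j) x]
  simp

/-- One summand is x itself and the others lie in Q, so pointedness excludes cancellation. -/
theorem permSum_ne_zero (hQ : IsProper Q) (hperm : IsPermInvariant Q)
    {x : EuclideanSpace ℝ (Fin n)} (hx : x ∈ Q) (h0 : x ≠ 0) : permSum x ≠ 0 := by
  classical
  intro h
  rw [permSum, ← Finset.add_sum_erase _ _ (Finset.mem_univ 1)] at h
  exact h0 (hQ.eq_zero_of_add_eq_zero hx (Q.sum_mem fun σ _ => hperm.permute_mem σ hx) h)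

/-- A diagonal map that commutes with all permutations has a single eigenvalue. -/
theorem eigenvalue_eq_of_commute (hQ : IsProper Q) (hperm : IsPermInvariant Q)
    {L : EuclideanSpace ℝ (Fin n) →ₗ[ℝ] EuclideanSpace ℝ (Fin n)}
    (hL : ∀ σ x, L (permute σ x) = permute σ (L x)) {x y : EuclideanSpace ℝ (Fin n)}
    (hx : x ∈ Q) (hx0 : x ≠ 0) (hy : y ∈ Q) (hy0 : y ≠ 0) {a b : ℝ}
    (hxa : L x = a • x) (hyb : L y = b • y) : a = b := by
  have hsum : ∀ (z : EuclideanSpace ℝ (Fin n)) (c : ℝ), L z = c • z →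
      L (permSum z) = c • permSum z := by
    intro z c hz
    simp only [permSum, map_sum, hL, hz, map_smul, Finset.smul_sum]
  have hpx := permSum_ne_zero hQ hperm hx hx0
  have hpy := permSum_ne_zero hQ hperm hy hy0
  obtain ⟨i, hi⟩ : ∃ i, permSum x i ≠ 0 := by
    by_contra! h
    exact hpx (by ext i; simpa using h i)
  -- Both orbit sums have constant coordinates, hence are parallel; L scales one by a and the other
  -- by b.
  have hprop : permSum y = (permSum y i / permSum x i) • permSum x := by
    ext j
    rw [PiLp.smul_apply, smul_eq_mul, permSum_apply_eq x j i, div_mul_cancel₀ _ hi,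
      permSum_apply_eq y j i]
  have h1 := hsum y b hyb
  rw [hprop, map_smul, hsum x a hxa, smul_comm, ← hprop] at h1
  exact smul_left_injective ℝ hpy h1

/-! ### Commutation defect of a transposition. -/

/-- The defect of commutation of `L` with the transposition of `i` and `j`. -/
noncomputable def swapDefect (L : EuclideanSpace ℝ (Fin n) →ₗ[ℝ] EuclideanSpace ℝ (Fin n))
    (i j : Fin n) : EuclideanSpace ℝ (Fin n) →ₗ[ℝ] EuclideanSpace ℝ (Fin n) :=
  L - (permute (Equiv.swap i j)).toLinearEquiv.toLinearMap ∘ₗ L ∘ₗ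
    (permute (Equiv.swap i j)).toLinearEquiv.toLinearMap

variable {L : EuclideanSpace ℝ (Fin n) →ₗ[ℝ] EuclideanSpace ℝ (Fin n)}

theorem swapDefect_apply (i j : Fin n) (x : EuclideanSpace ℝ (Fin n)) :
    swapDefect L i j x =
      L x - permute (Equiv.swap i j) (L (permute (Equiv.swap i j) x)) := rfl

/-- Conjugating by the transposition exchanges the two terms of the defect. So an eigenvalue a at d
becomes -a at the swapped vector. -/
theorem swapDefect_permute_swap (i j : Fin n) (x : EuclideanSpace ℝ (Fin n)) :
    swapDefect L i j (permute (Equiv.swap i j) x) =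
      -permute (Equiv.swap i j) (swapDefect L i j x) := by
  simp [swapDefect_apply, permute_swap_permute_swap]

theorem isDiagonalOn_swapDefect (hperm : IsPermInvariant Q) (hL : IsDiagonalOn Q L)
    (i j : Fin n) : IsDiagonalOn Q (swapDefect L i j) := by
  intro d hd
  obtain ⟨a, ha⟩ := hL d hd
  obtain ⟨b, hb⟩ := hL _ (hperm.isExtremeVector_permute (Equiv.swap i j) hd)
  exact ⟨a - b, by rw [swapDefect_apply, ha, hb, map_smul, permute_swap_permute_swap, sub_smul]⟩

/-- The transposition moves every vector by a multiple of one fixed u, so the terms L x cancel and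
only multiples of u and L u remain. -/
theorem exists_swapDefect_mem_span_pair (i j : Fin n) :
    ∃ u v : EuclideanSpace ℝ (Fin n), ∀ x, swapDefect L i j x ∈ Submodule.span ℝ {u, v} := by
  obtain ⟨u, hu⟩ : ∃ u : EuclideanSpace ℝ (Fin n), ∀ x,
      permute (Equiv.swap i j) x = x - (x i - x j) • u := ⟨_, permute_swap_eq i j⟩
  refine ⟨u, L u, fun x => ?_⟩
  rw [swapDefect_apply, hu x, hu (L _), map_sub, map_smul, Submodule.mem_span_pair]
  exact ⟨(L x - (x i - x j) • L u) i - (L x - (x i - x j) • L u) j, x i - x j, by abel⟩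

/-- Three eigenvectors in a plane, the first two with opposite nonzero eigenvalues: the third is a
multiple of one of them. -/
theorem eq_smul_or_eq_smul_of_mem_span_pair {V : Type*} [AddCommGroup V] [Module ℝ V]
    {D : V →ₗ[ℝ] V} {u v d d' e : V} (hD : ∀ x, D x ∈ Submodule.span ℝ {u, v}) {a b : ℝ}
    (ha : a ≠ 0) (hb : b ≠ 0) (hd : D d = a • d) (hd' : D d' = -a • d') (he : D e = b • e)
    (hd0 : d ≠ 0) (hd'0 : d' ≠ 0) : (∃ c : ℝ, e = c • d) ∨ ∃ c : ℝ, e = c • d' := by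
  have hmem : ∀ (x : V) (c : ℝ), c ≠ 0 → D x = c • x → x ∈ Submodule.span ℝ {u, v} :=
    fun x c hc hx => (Submodule.smul_mem_iff _ hc).1 (hx ▸ hD x)
  have hli : LinearIndependent ℝ ![d, d'] := by
    rw [LinearIndependent.pair_iff]
    intro s t hst
    have h1 : a • (s • d - t • d') = 0 := by
      have := congrArg D hst
      rw [map_add, map_smul, map_smul, hd, hd', map_zero] at this
      rw [← this]
      module
    have h2 := (smul_eq_zero.1 h1).resolve_left ha
    have hs : (2 * s) • d = 0 := by
      have : (2 * s) • d = (s • d + t • d') + (s • d - t • d') := by module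
      rw [this, hst, h2, add_zero]
    have ht : (2 * t) • d' = 0 := by
      have : (2 * t) • d' = (s • d + t • d') - (s • d - t • d') := by module
      rw [this, hst, h2, sub_zero]
    have hs' := (smul_eq_zero.1 hs).resolve_right hd0
    have ht' := (smul_eq_zero.1 ht).resolve_right hd'0
    exact ⟨by linarith, by linarith⟩
  have hspan : Submodule.span ℝ {d, d'} = Submodule.span ℝ {u, v} := by
    classical
    have : FiniteDimensional ℝ (Submodule.span ℝ {u, v}) :=
      FiniteDimensional.span_of_finite ℝ (Set.toFinite _)
    refine Submodule.eq_of_le_of_finrank_le ?_ ?_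
    · rw [Submodule.span_le, Set.insert_subset_iff, Set.singleton_subset_iff]
      exact ⟨hmem d a ha hd, hmem d' (-a) (neg_ne_zero.2 ha) hd'⟩
    · have h2 : Module.finrank ℝ (Submodule.span ℝ {d, d'}) = 2 := by
        have := finrank_span_eq_card hli
        rwa [Matrix.range_cons_cons_empty, Fintype.card_fin] at this
      rw [h2]
      have := finrank_span_finset_le_card (R := ℝ) ({u, v} : Finset V)
      rw [Finset.coe_pair] at this
      exact this.trans Finset.card_le_two
  have hemem := hmem e b hb he
  rw [← hspan, Submodule.mem_span_pair] at hemem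
  obtain ⟨s, t, rfl⟩ := hemem
  -- Compare D e with b • e in the basis d, d'. Both coefficients of e can be nonzero only if b = a
  -- and b = -a, which forces a = 0.
  have hz : (s * (a - b)) • d + (t * (-a - b)) • d' = 0 := by
    rw [map_add, map_smul, map_smul, hd, hd', ← sub_eq_zero] at he
    rw [← he]
    module
  obtain ⟨h1, h2⟩ := LinearIndependent.pair_iff.1 hli _ _ hz
  rcases mul_eq_zero.1 h1 with rfl | hab
  · exact Or.inr ⟨t, by rw [zero_smul, zero_add]⟩
  rcases mul_eq_zero.1 h2 with rfl | hab'
  · exact Or.inl ⟨s, by rw [zero_smul, add_zero]⟩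
  exact absurd (by linarith : a = 0) ha

/-- All extreme vectors outside the kernel of a swap defect lie in one orbit. -/
theorem exists_permute_equivalent_of_swapDefect_ne_zero (hQ : IsProper Q)
    (hperm : IsPermInvariant Q) (hL : IsDiagonalOn Q L) {i j : Fin n}
    {d e : EuclideanSpace ℝ (Fin n)} (hd : IsExtremeVector Q d) (he : IsExtremeVector Q e)
    (hd0 : swapDefect L i j d ≠ 0) (he0 : swapDefect L i j e ≠ 0) :
    ∃ σ : Equiv.Perm (Fin n), Equivalent e (permute σ d) := by
  obtain ⟨u, v, huv⟩ := exists_swapDefect_mem_span_pair (L := L) i j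
  obtain ⟨a, ha⟩ := isDiagonalOn_swapDefect hperm hL i j d hd
  obtain ⟨b, hb⟩ := isDiagonalOn_swapDefect hperm hL i j e he
  have hd' := hperm.isExtremeVector_permute (Equiv.swap i j) hd
  have ha' : swapDefect L i j (permute (Equiv.swap i j) d) =
      -a • permute (Equiv.swap i j) d := by
    rw [swapDefect_permute_swap, ha, map_smul, neg_smul]
  have ha0 : a ≠ 0 := by rintro rfl; exact hd0 (by rw [ha, zero_smul])
  have hb0 : b ≠ 0 := by rintro rfl; exact he0 (by rw [hb, zero_smul])
  rcases eq_smul_or_eq_smul_of_mem_span_pair huv ha0 hb0 ha ha' hb hd.2.1 hd'.2.1 with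
    ⟨c, rfl⟩ | ⟨c, rfl⟩
  · exact ⟨1, c, hQ.pos_of_smul_mem hd.1 he.1 he.2.1, rfl⟩
  · exact ⟨Equiv.swap i j, c, hQ.pos_of_smul_mem hd'.1 he.1 he.2.1, rfl⟩

/-! ### Averaged squares and scalarity. -/

/-- The sum of the conjugates of `D ∘ D` under all coordinate permutations. -/
noncomputable def conjSqSum (D : EuclideanSpace ℝ (Fin n) →ₗ[ℝ] EuclideanSpace ℝ (Fin n)) :
    EuclideanSpace ℝ (Fin n) →ₗ[ℝ] EuclideanSpace ℝ (Fin n) :=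
  ∑ σ : Equiv.Perm (Fin n), (permute σ⁻¹).toLinearEquiv.toLinearMap ∘ₗ (D ∘ₗ D) ∘ₗ
    (permute σ).toLinearEquiv.toLinearMap

theorem conjSqSum_apply (D : EuclideanSpace ℝ (Fin n) →ₗ[ℝ] EuclideanSpace ℝ (Fin n))
    (x : EuclideanSpace ℝ (Fin n)) :
    conjSqSum D x = ∑ σ : Equiv.Perm (Fin n), permute σ⁻¹ (D (D (permute σ x))) := by
  simp [conjSqSum]

theorem conjSqSum_permute (D : EuclideanSpace ℝ (Fin n) →ₗ[ℝ] EuclideanSpace ℝ (Fin n))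
    (τ : Equiv.Perm (Fin n)) (x : EuclideanSpace ℝ (Fin n)) :
    conjSqSum D (permute τ x) = permute τ (conjSqSum D x) := by
  rw [conjSqSum_apply, conjSqSum_apply, map_sum]
  refine Fintype.sum_equiv (Equiv.mulRight τ) _ _ fun σ => ?_
  rw [Equiv.coe_mulRight, mul_inv_rev, permute_mul τ⁻¹, permute_permute_inv, permute_mul σ]

/-- With two orbits of extreme rays, every diagonal map commutes with all transpositions. -/
theorem swapDefect_eq_zero_of_isExtremeVector (hQ : IsProper Q) (hperm : IsPermInvariant Q)
    (hL : IsDiagonalOn Q L)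
    (hext : ∃ d₁ d₂ : EuclideanSpace ℝ (Fin n), IsExtremeVector Q d₁ ∧ IsExtremeVector Q d₂ ∧
      ∀ σ : Equiv.Perm (Fin n), ¬ Equivalent (permute σ d₁) d₂) (i j : Fin n)
    {d : EuclideanSpace ℝ (Fin n)} (hd : IsExtremeVector Q d) : swapDefect L i j d = 0 := by
  classical
  by_contra hne
  -- If d₁ and d₂ were both equivalent to permutations of d, they would lie in one orbit.
  obtain ⟨e, he, hed⟩ : ∃ e, IsExtremeVector Q e ∧
      ∀ σ : Equiv.Perm (Fin n), ¬ Equivalent e (permute σ d) := by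
    obtain ⟨d₁, d₂, hd₁, hd₂, h⟩ := hext
    by_contra! hc
    obtain ⟨σ, hσ⟩ := hc d₁ hd₁
    obtain ⟨τ, hτ⟩ := hc d₂ hd₂
    have h1 := hσ.permute (τ * σ⁻¹)
    rw [← permute_mul, inv_mul_cancel_right] at h1
    exact h _ (h1.trans hτ.symm)
  set D := swapDefect L i j with hDdef
  have hzero : conjSqSum D e = (0 : ℝ) • e := by
    rw [conjSqSum_apply, zero_smul]
    refine Finset.sum_eq_zero fun σ _ => ?_
    have : D (permute σ e) = 0 := by
      by_contra hσ
      obtain ⟨τ, hτ⟩ := exists_permute_equivalent_of_swapDefect_ne_zero hQ hperm hL hd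
        (hperm.isExtremeVector_permute σ he) hne hσ
      have := hτ.permute σ⁻¹
      rw [permute_inv_permute, ← permute_mul] at this
      exact hed _ this
    rw [this, map_zero, map_zero]
  choose c hc using fun σ => isDiagonalOn_swapDefect hperm hL i j _
    (hperm.isExtremeVector_permute σ hd)
  rw [← hDdef] at hc
  -- Squaring prevents cancellation: the eigenvalues of D on the orbit of d come in pairs c, -c. The
  -- term of the identity is positive if D d ≠ 0.
  have hsum : conjSqSum D d = (∑ σ, c σ ^ 2) • d := by
    rw [conjSqSum_apply, Finset.sum_smul]
    refine Finset.sum_congr rfl fun σ _ => ?_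
    rw [hc, map_smul, hc, map_smul, map_smul, permute_inv_permute, smul_smul, sq]
  have h0 := eigenvalue_eq_of_commute hQ hperm (conjSqSum_permute D) hd.1 hd.2.1 he.1 he.2.1
    hsum hzero
  have h1 := (Finset.sum_eq_zero_iff_of_nonneg fun σ _ => sq_nonneg (c σ)).1 h0 1
    (Finset.mem_univ _)
  refine hne ?_
  rw [← permute_one d, hc, pow_eq_zero_iff two_ne_zero |>.1 h1, zero_smul]

/-- With two orbits of extreme rays, only scalar maps are diagonal on the extreme rays. -/
theorem IsDiagonalOn.exists_eq_smul (hQ : IsProper Q) (hP : IsPolyhedral Q)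
    (hperm : IsPermInvariant Q)
    (hext : ∃ d₁ d₂ : EuclideanSpace ℝ (Fin n), IsExtremeVector Q d₁ ∧ IsExtremeVector Q d₂ ∧
      ∀ σ : Equiv.Perm (Fin n), ¬ Equivalent (permute σ d₁) d₂)
    (hL : IsDiagonalOn Q L) : ∃ μ : ℝ, ∀ x, L x = μ • x := by
  have hswap : ∀ i j x, L (permute (Equiv.swap i j) x) = permute (Equiv.swap i j) (L x) := by
    intro i j x
    have h0 : swapDefect L i j = 0 :=
      LinearMap.ext_on (hQ.span_isExtremeVector hP) fun d hd =>
        swapDefect_eq_zero_of_isExtremeVector hQ hperm hL hext i j hd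
    have := LinearMap.congr_fun h0 x
    rw [swapDefect_apply, LinearMap.zero_apply, sub_eq_zero] at this
    rw [this, permute_swap_permute_swap]
  have hcomm : ∀ σ x, L (permute σ x) = permute σ (L x) := by
    intro σ
    induction σ using Equiv.Perm.swap_induction_on with
    | one => simp
    | swap_mul σ i j _ ih =>
      intro x
      rw [permute_mul, hswap, ih, permute_mul]
  obtain ⟨d₁, -, hd₁, -, -⟩ := hext
  obtain ⟨μ, hμ⟩ := hL d₁ hd₁
  refine ⟨μ, fun x => ?_⟩
  have : L = μ • LinearMap.id := LinearMap.ext_on (hQ.span_isExtremeVector hP) fun d hd => by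
    obtain ⟨b, hb⟩ := hL d hd
    rw [hb, eigenvalue_eq_of_commute hQ hperm hcomm hd.1 hd.2.1 hd₁.1 hd₁.2.1 hb hμ]
    simp
  rw [this]
  simp

end Permutation

end LyapunovCone

theorem mainTheorem4 (n : ℕ) (Q : PointedCone ℝ (EuclideanSpace ℝ (Fin n)))
    (hproper : LyapunovCone.IsProper Q) (hpoly : LyapunovCone.IsPolyhedral Q)
    (hperm : LyapunovCone.IsPermInvariant Q)
    (hext : ∃ d₁ d₂ : EuclideanSpace ℝ (Fin n),
      LyapunovCone.IsExtremeVector Q d₁ ∧ LyapunovCone.IsExtremeVector Q d₂ ∧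
        ∀ σ : Equiv.Perm (Fin n), ¬ LyapunovCone.Equivalent (LyapunovCone.permute σ d₁) d₂) :
    LyapunovCone.IsIrreducible Q ∧ LyapunovCone.lyapunovRank Q = 1 := by
  have h : ∀ L, LyapunovCone.IsDiagonalOn Q L → ∃ μ : ℝ, ∀ x, L x = μ • x := fun _ hL =>
    hL.exists_eq_smul hproper hpoly hperm hext
  obtain ⟨d, -, hd, -, -⟩ := hext
  refine ⟨⟨fun hbot => hd.2.1 ?_, hproper.not_isReducible h⟩,
    hpoly.lyapunovRank_eq_one hd.2.1 h⟩
  have hdQ := hd.1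
  rwa [hbot, Submodule.mem_bot] at hdQ
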